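/- **Theorem (Excision).** Let $M$ be a smooth $n$-dimensional manifold (without boundary, Hausdorff, second countable) and let $f\colon M\to\mathbb R$ be a smooth function. For a subset $A\subseteq M$, let $\Omega^k(A)$ be the space of $k$-forms that are defined and smooth on some neighbourhood of $A$ in $M$, modulo those forms $\alpha$ that restrict to zero on $A$, meaning that $\gamma^*\alpha=0$ for every smooth map $\gamma\colon O\to M$ from an open subset $O$ of some $\mathbb R^m$ with $\gamma(O)\subseteq A$. (If $A$ is an embedded submanifold, possibly with boundary, this is the usual space of smooth $k$-forms on $A$; if $A$ is the closure of an open subset of $M$, it is the quotient of $\Omega^k(M)$ by the $k$-forms vanishing at all points of $A$.) The operator $$d_f\alpha=f\,d\alpha-k\,df\wedge\alpha\qquad(\alpha\in\Omega^k(A))$$ satisfies $d_f\circ d_f=0$ and commutes with restrictions. For $A\subseteq B\subseteq M$, the relative cohomology $H^\bullet_f(B,A)$ is the cohomology of the complex $$\Omega^k(B,A)=\Omega^k(B)\oplus\Omega^{k-1}(A),\qquad d(\alpha,\theta)=(d_f\alpha,\ \alpha|_A-d_f\theta),\qquad k\ge 0,\quad \Omega^{-1}(A)=0 .$$ For $A'\subseteq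 A$ and $A'\subseteq B'\subseteq B$, the inclusion $(B',A')\hookrightarrow(B,A)$ induces $H^\bullet_f(B,A)\to H^\bullet_f(B',A')$ through $(\alpha,\theta)\mapsto(\alpha|_{B'},\theta|_{A'})$. Let $N\subseteq M$ be any subset (for example an embedded submanifold, possibly with boundary, or the closure of an open subset), and let $U$ be an open subset of $M$ whose closure is contained in the interior of $N$. Then for every $k\ge 0$ the inclusion $j\colon(M\setminus U,N\setminus U)\hookrightarrow(M,N)$ induces an isomorphism $$j^*\colon H^k_f(M,N)\longrightarrow H^k_f(M\setminus U,N\setminus U).$$ -/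

import Mathlib

set_option linter.unusedSectionVars false

open Set Filter CategoryTheory
open scoped Manifold ContDiff Topology

noncomputable section

namespace FunctionCohomology

/-! ### Differential forms on a manifold modelled on `E`

The tangent space `TangentSpace 𝓘(ℝ, E) x` of `M` at `x` is by definition the model space `E`
(identified through the preferred chart at `x`). So a (not necessarily smooth) `k`-form on `M`
is a function `α : M → E [⋀^Fin k]→L[ℝ] ℝ`, with `α x` an alternating `k`-form on `T_x M`. -/

section Raw

variable {E : Type*} [NormedAddCommGroup E] [NormedSpace ℝ E]
  {F : Type*} [NormedAddCommGroup F] [NormedSpace ℝ F]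
  {M : Type*} [TopologicalSpace M] [ChartedSpace E M]

/-- The differential of a map between manifolds, as a linear map of the model spaces. -/
def dAt {X Y : Type*} [TopologicalSpace X] [ChartedSpace F X] [TopologicalSpace Y]
    [ChartedSpace E Y] (g : X → Y) (x : X) : F →L[ℝ] E :=
  mfderiv 𝓘(ℝ, F) 𝓘(ℝ, E) g x

/-- The pullback `γ^* α` of a form on `M` by a map `γ` from a vector space to `M`. -/
def pullback {k : ℕ} (γ : F → M) (α : M → E [⋀^Fin k]→L[ℝ] ℝ) (y : F) : F [⋀^Fin k]→L[ℝ] ℝ :=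
  (α (γ y)).compContinuousLinearMap (dAt γ y)

/-- `α` is smooth on the open set `W`: its coefficients are smooth in every chart. -/
def IsSmoothOn {k : ℕ} (α : M → E [⋀^Fin k]→L[ℝ] ℝ) (W : Set M) : Prop :=
  ∀ e ∈ atlas E M, ContDiffOn ℝ ∞ (pullback e.symm α) (e.target ∩ e.symm ⁻¹' W)

/-- The exterior derivative `dα` on `M`, computed at `x` in the preferred chart at `x`
(by `extDeriv_pullback_eq` below, any other chart gives the same result). -/
def extD {k : ℕ} (α : M → E [⋀^Fin k]→L[ℝ] ℝ) (x : M) : E [⋀^Fin (k + 1)]→L[ℝ] ℝ :=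
  (extDeriv (pullback (chartAt E x).symm α) (chartAt E x x)).compContinuousLinearMap
    (dAt (chartAt E x) x)

/-- The exterior product `l ∧ a` of a linear form and an alternating `k`-form,
`(l ∧ a)(v₀, …, v_k) = ∑ i, (-1)^i l(v_i) a(v₀, …, v̂_i, …, v_k)`. -/
def wedge {k : ℕ} (l : F →L[ℝ] ℝ) (a : F [⋀^Fin k]→L[ℝ] ℝ) : F [⋀^Fin (k + 1)]→L[ℝ] ℝ :=
  ContinuousAlternatingMap.alternatizeUncurryFin (l.smulRight a)

/-- The form `df ∧ α`. -/
def dWedge {k : ℕ} (f : M → ℝ) (α : M → E [⋀^Fin k]→L[ℝ] ℝ) (x : M) :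
    E [⋀^Fin (k + 1)]→L[ℝ] ℝ :=
  wedge (dAt f x) (α x)

/-- The operator `d_f α = f dα - k df ∧ α` on `k`-forms. -/
def rawD {k : ℕ} (f : M → ℝ) (α : M → E [⋀^Fin k]→L[ℝ] ℝ) (x : M) :
    E [⋀^Fin (k + 1)]→L[ℝ] ℝ :=
  f x • extD α x - (k : ℝ) • dWedge f α x

theorem wedge_apply {k : ℕ} (l : F →L[ℝ] ℝ) (a : F [⋀^Fin k]→L[ℝ] ℝ) (v : Fin (k + 1) → F) :
    wedge l a v = ∑ i : Fin (k + 1), (-1 : ℤ) ^ (i : ℕ) • (l (v i) * a (i.removeNth v)) := by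
  simp [wedge, ContinuousAlternatingMap.alternatizeUncurryFin_apply]

theorem wedge_add {k : ℕ} (l : F →L[ℝ] ℝ) (a b : F [⋀^Fin k]→L[ℝ] ℝ) :
    wedge l (a + b) = wedge l a + wedge l b := by
  ext v; simp [wedge_apply, mul_add, Finset.sum_add_distrib]

theorem wedge_smul {k : ℕ} (l : F →L[ℝ] ℝ) (c : ℝ) (a : F [⋀^Fin k]→L[ℝ] ℝ) :
    wedge l (c • a) = c • wedge l a := by
  ext v; simp [wedge_apply, Finset.mul_sum, mul_left_comm]

theorem wedge_zero {k : ℕ} (l : F →L[ℝ] ℝ) : wedge l (0 : F [⋀^Fin k]→L[ℝ] ℝ) = 0 := by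
  ext v; simp [wedge_apply]

theorem wedge_wedge {k : ℕ} (l : F →L[ℝ] ℝ) (a : F [⋀^Fin k]→L[ℝ] ℝ) :
    wedge l (wedge l a) = 0 := by
  have h := ContinuousAlternatingMap.alternatizeUncurryFin_alternatizeUncurryFinCLM_comp_of_symmetric
    (f := l.smulRight (l.smulRight a)) (by intro x y; ext v; simp; ring)
  rw [← h]
  unfold wedge
  congr 1
  ext v w
  simp [ContinuousAlternatingMap.alternatizeUncurryFin_apply, Finset.mul_sum, mul_left_comm]

theorem wedge_comp {k : ℕ} (l : E →L[ℝ] ℝ) (a : E [⋀^Fin k]→L[ℝ] ℝ) (g : F →L[ℝ] E) :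
    (wedge l a).compContinuousLinearMap g = wedge (l.comp g) (a.compContinuousLinearMap g) := by
  ext v
  simp [wedge_apply, Function.comp_def]
  rfl

theorem pullback_add {k : ℕ} (γ : F → M) (α η : M → E [⋀^Fin k]→L[ℝ] ℝ) :
    pullback γ (α + η) = pullback γ α + pullback γ η := by
  ext y v; simp [pullback]

theorem pullback_smul {k : ℕ} (γ : F → M) (c : ℝ) (α : M → E [⋀^Fin k]→L[ℝ] ℝ) :
    pullback γ (c • α) = c • pullback γ α := by
  ext y v; simp [pullback]

theorem IsSmoothOn.mono {k : ℕ} {α : M → E [⋀^Fin k]→L[ℝ] ℝ} {W W' : Set M}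
    (h : IsSmoothOn α W) (hW : W' ⊆ W) : IsSmoothOn α W' :=
  fun e he => (h e he).mono (inter_subset_inter_right _ (preimage_mono hW))

theorem IsSmoothOn.add {k : ℕ} {α η : M → E [⋀^Fin k]→L[ℝ] ℝ} {W : Set M}
    (h : IsSmoothOn α W) (h' : IsSmoothOn η W) : IsSmoothOn (α + η) W := fun e he => by
  rw [pullback_add]; exact (h e he).add (h' e he)

theorem IsSmoothOn.smul {k : ℕ} {α : M → E [⋀^Fin k]→L[ℝ] ℝ} {W : Set M}
    (c : ℝ) (h : IsSmoothOn α W) : IsSmoothOn (c • α) W := fun e he => by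
  rw [pullback_smul]; exact contDiffOn_const.smul (h e he)

theorem IsSmoothOn.congr {k : ℕ} {α η : M → E [⋀^Fin k]→L[ℝ] ℝ} {W : Set M}
    (h : IsSmoothOn α W) (h' : EqOn η α W) : IsSmoothOn η W := fun e he =>
  (h e he).congr fun y hy => by simp only [pullback]; rw [h' hy.2]

theorem two_le_smooth : minSmoothness ℝ 2 ≤ (∞ : WithTop ℕ∞) := by
  rw [minSmoothness_of_isRCLikeNormedField]
  exact WithTop.coe_le_coe.2 le_top

theorem isOpen_chart {W : Set M} (hW : IsOpen W) (e : OpenPartialHomeomorph M E) :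
    IsOpen (e.target ∩ e.symm ⁻¹' W) := e.isOpen_inter_preimage_symm hW

theorem extD_smul {k : ℕ} (c : ℝ) (α : M → E [⋀^Fin k]→L[ℝ] ℝ) (x : M) :
    extD (c • α) x = c • extD α x := by
  simp only [extD]
  rw [pullback_smul, extDeriv_smul]
  ext v; simp

variable [IsManifold 𝓘(ℝ, E) ∞ M]

/-- The exterior derivative commutes with the pullback by smooth maps. -/
theorem extDeriv_pullback_eq {k : ℕ} {α : M → E [⋀^Fin k]→L[ℝ] ℝ} {W : Set M} (hW : IsOpen W)
    (hα : IsSmoothOn α W) {γ : F → M} {O : Set F} (hO : IsOpen O)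
    (hγ : ContMDiffOn 𝓘(ℝ, F) 𝓘(ℝ, E) ∞ γ O) {y : F} (hy : y ∈ O) (hyW : γ y ∈ W) :
    extDeriv (pullback γ α) y = pullback γ (extD α) y := by
  set c := chartAt E (γ y) with hc
  have hca : c ∈ atlas E M := chart_mem_atlas E (γ y)
  have hys : γ y ∈ c.source := mem_chart_source E (γ y)
  have hcont : ContinuousAt γ y := (hγ.continuousOn.continuousAt (hO.mem_nhds hy))
  have hev : ∀ᶠ z in 𝓝 y, z ∈ O ∧ γ z ∈ c.source :=
    (hO.eventually_mem hy).and (hcont.eventually (c.open_source.eventually_mem hys))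
  have hcd : ∀ x ∈ c.source, MDifferentiableAt 𝓘(ℝ, E) 𝓘(ℝ, E) c x := fun x hx =>
    mdifferentiableAt_atlas (I := 𝓘(ℝ, E)) hca hx
  have hcsd : ∀ x ∈ c.target, MDifferentiableAt 𝓘(ℝ, E) 𝓘(ℝ, E) c.symm x := fun x hx =>
    mdifferentiableAt_atlas_symm (I := 𝓘(ℝ, E)) hca hx
  have hγd : ∀ z ∈ O, MDifferentiableAt 𝓘(ℝ, F) 𝓘(ℝ, E) γ z := fun z hz =>
    ((hγ.contMDiffAt (hO.mem_nhds hz)).mdifferentiableAt (by simp))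
  have hgd : ∀ z ∈ O, γ z ∈ c.source → fderiv ℝ (c ∘ γ) z =
      (dAt (E := E) (F := E) c (γ z)).comp (dAt (E := E) (F := F) γ z) := by
    intro z hz hs
    rw [← mfderiv_eq_fderiv]
    exact mfderiv_comp z (hcd _ hs) (hγd z hz)
  have key : pullback γ α =ᶠ[𝓝 y] fun z =>
      (pullback c.symm α ((c ∘ γ) z)).compContinuousLinearMap (fderiv ℝ (c ∘ γ) z) := by
    filter_upwards [eventually_eventually_nhds.2 hev] with z hz
    have hz0 := hz.self_of_nhds
    have e1 : c.symm (c (γ z)) = γ z := c.left_inv hz0.2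
    have e2 : dAt (E := E) (F := F) γ z =
        (dAt (E := E) (F := E) c.symm (c (γ z))).comp (fderiv ℝ (c ∘ γ) z) := by
      have hcg : MDifferentiableAt 𝓘(ℝ, F) 𝓘(ℝ, E) (c ∘ γ) z :=
        (hcd _ hz0.2).comp z (hγd z hz0.1)
      have h2 := mfderiv_comp z (g := c.symm) (f := c ∘ γ)
        (hcsd _ (c.map_source hz0.2)) hcg
      have h3 : (c.symm ∘ (c ∘ γ)) =ᶠ[𝓝 z] γ := by
        filter_upwards [hz] with w hw using c.left_inv hw.2
      rw [h3.mfderiv_eq] at h2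
      rw [← mfderiv_eq_fderiv]
      exact h2
    ext v
    simp only [pullback, Function.comp_apply, e1, e2,
      ContinuousAlternatingMap.compContinuousLinearMap_apply]
    rfl
  have hgs : ContDiffAt ℝ ∞ (c ∘ γ) y := by
    rw [← contMDiffAt_iff_contDiffAt]
    exact (contMDiffAt_of_mem_maximalAtlas
      (IsManifold.subset_maximalAtlas hca) hys).comp y (hγ.contMDiffAt (hO.mem_nhds hy))
  have hmem : (c ∘ γ) y ∈ c.target ∩ c.symm ⁻¹' W :=
    ⟨c.map_source hys, by simpa [c.left_inv hys] using hyW⟩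
  have hαd : DifferentiableAt ℝ (pullback c.symm α) ((c ∘ γ) y) :=
    ((hα c hca).contDiffAt ((isOpen_chart hW c).mem_nhds hmem)).differentiableAt (by simp)
  rw [key.extDeriv_eq, extDeriv_pullback hαd hgs two_le_smooth, hgd y hy hys]
  ext v
  simp only [pullback, extD, Function.comp_apply, ← hc,
    ContinuousAlternatingMap.compContinuousLinearMap_apply]
  rfl

theorem pullback_symm_extD {k : ℕ} {α : M → E [⋀^Fin k]→L[ℝ] ℝ} {W : Set M} (hW : IsOpen W)
    (hα : IsSmoothOn α W) {e : OpenPartialHomeomorph M E} (he : e ∈ atlas E M) :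
    EqOn (pullback e.symm (extD α)) (extDeriv (pullback e.symm α))
      (e.target ∩ e.symm ⁻¹' W) := fun _ hy =>
  (extDeriv_pullback_eq hW hα e.open_target
    (contMDiffOn_symm_of_mem_maximalAtlas (IsManifold.subset_maximalAtlas he)) hy.1 hy.2).symm

theorem isSmoothOn_extD {k : ℕ} {α : M → E [⋀^Fin k]→L[ℝ] ℝ} {W : Set M} (hW : IsOpen W)
    (hα : IsSmoothOn α W) : IsSmoothOn (extD α) W := fun e he => by
  refine ContDiffOn.congr ?_ (pullback_symm_extD hW hα he)
  have h := (hα e he).fderiv_of_isOpen (isOpen_chart hW e) (m := ∞) (by simp)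
  exact (ContinuousAlternatingMap.alternatizeUncurryFinCLM ℝ E ℝ).contDiff.comp_contDiffOn h

theorem chart_mem {W : Set M} {x : M} (hx : x ∈ W) :
    chartAt E x x ∈ (chartAt E x).target ∩ (chartAt E x).symm ⁻¹' W :=
  ⟨mem_chart_target E x, by simpa using hx⟩

theorem extD_extD {k : ℕ} {α : M → E [⋀^Fin k]→L[ℝ] ℝ} {W : Set M} (hW : IsOpen W)
    (hα : IsSmoothOn α W) {x : M} (hx : x ∈ W) :
    extD (extD α) x = 0 := by
  have hmem := (isOpen_chart hW (chartAt E x)).mem_nhds (chart_mem (E := E) hx)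
  have h := (pullback_symm_extD hW hα (chart_mem_atlas E x)).eventuallyEq_of_mem hmem
  rw [extD, h.extDeriv_eq, extDeriv_extDeriv_apply
    ((hα _ (chart_mem_atlas E x)).contDiffAt hmem)
    two_le_smooth]
  ext v; simp

theorem differentiableAt_chart {k : ℕ} {α : M → E [⋀^Fin k]→L[ℝ] ℝ} {W : Set M} (hW : IsOpen W)
    (hα : IsSmoothOn α W) {x : M} (hx : x ∈ W) :
    DifferentiableAt ℝ (pullback (chartAt E x).symm α) (chartAt E x x) :=
  ((hα _ (chart_mem_atlas E x)).contDiffAt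
    ((isOpen_chart hW (chartAt E x)).mem_nhds (chart_mem (E := E) hx))).differentiableAt (by simp)

theorem extD_add {k : ℕ} {α η : M → E [⋀^Fin k]→L[ℝ] ℝ} {W : Set M} (hW : IsOpen W)
    (hα : IsSmoothOn α W) (hη : IsSmoothOn η W) {x : M} (hx : x ∈ W) :
    extD (α + η) x =
      extD α x + extD η x := by
  simp only [extD]
  rw [pullback_add, extDeriv_add (differentiableAt_chart hW hα hx)
    (differentiableAt_chart hW hη hx)]
  ext v; simp

theorem extD_congr {k : ℕ} {α η : M → E [⋀^Fin k]→L[ℝ] ℝ} {W : Set M} (hW : IsOpen W)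
    (h : EqOn α η W) {x : M} (hx : x ∈ W) : extD α x = extD η x := by
  have hmem := (isOpen_chart hW (chartAt E x)).mem_nhds (chart_mem (E := E) hx)
  have h' : EqOn (pullback (chartAt E x).symm α) (pullback (chartAt E x).symm η)
      ((chartAt E x).target ∩ (chartAt E x).symm ⁻¹' W) := fun y hy => by
    simp only [pullback]; rw [h hy.2]
  simp only [extD, (h'.eventuallyEq_of_mem hmem).extDeriv_eq]

theorem contDiffOn_comp_symm {f : M → ℝ} (hf : ContMDiff 𝓘(ℝ, E) 𝓘(ℝ, ℝ) ∞ f)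
    {e : OpenPartialHomeomorph M E} (he : e ∈ atlas E M) :
    ContDiffOn ℝ ∞ (f ∘ e.symm) e.target := by
  rw [← contMDiffOn_iff_contDiffOn]
  exact hf.comp_contMDiffOn
    (contMDiffOn_symm_of_mem_maximalAtlas (IsManifold.subset_maximalAtlas he))

theorem IsSmoothOn.fun_smul {k : ℕ} {α : M → E [⋀^Fin k]→L[ℝ] ℝ} {W : Set M} {f : M → ℝ}
    (hf : ContMDiff 𝓘(ℝ, E) 𝓘(ℝ, ℝ) ∞ f) (h : IsSmoothOn α W) :
    IsSmoothOn (fun x => f x • α x) W := fun e he => by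
  have h1 := ((contDiffOn_comp_symm hf he).mono inter_subset_left).smul (h e he)
  exact h1.congr fun y _ => by ext v; simp [pullback]

/-- The Leibniz rule `d(f α) = df ∧ α + f dα`. -/
theorem extD_fun_smul {k : ℕ} {α : M → E [⋀^Fin k]→L[ℝ] ℝ} {W : Set M} {f : M → ℝ}
    (hf : ContMDiff 𝓘(ℝ, E) 𝓘(ℝ, ℝ) ∞ f) (hW : IsOpen W) (hα : IsSmoothOn α W)
    {x : M} (hx : x ∈ W) :
    extD (fun x => f x • α x) x = dWedge f α x + f x • extD α x := by
  set c := chartAt E x with hc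
  have hca : c ∈ atlas E M := chart_mem_atlas E x
  have hxs : x ∈ c.source := mem_chart_source E x
  have hct : c x ∈ c.target := c.map_source hxs
  have hsx : c.symm (c x) = x := c.left_inv hxs
  have hp : pullback c.symm (fun x => f x • α x) =
      fun y => (f ∘ c.symm) y • pullback c.symm α y := by
    funext y; ext v; simp [pullback]
  have hfd : DifferentiableAt ℝ (f ∘ c.symm) (c x) :=
    ((contDiffOn_comp_symm hf hca).contDiffAt (c.open_target.mem_nhds hct)).differentiableAt
      (by simp)
  have hm := mdifferentiable_of_mem_atlas (I := 𝓘(ℝ, E)) hca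
  have hid : (dAt (E := E) (F := E) c.symm (c x)).comp (dAt (E := E) (F := E) c x) =
      ContinuousLinearMap.id ℝ E := hm.symm_comp_deriv hxs
  have hfc : (fderiv ℝ (f ∘ c.symm) (c x)).comp (dAt (E := E) (F := E) c x) =
      dAt (E := ℝ) (F := E) f x := by
    have hdf : MDifferentiableAt 𝓘(ℝ, E) 𝓘(ℝ, ℝ) f (c.symm (c x)) :=
      (hf _).mdifferentiableAt (by simp)
    have h1 : fderiv ℝ (f ∘ c.symm) (c x) =
        (dAt (E := ℝ) (F := E) f (c.symm (c x))).comp (dAt (E := E) (F := E) c.symm (c x)) := by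
      rw [← mfderiv_eq_fderiv]
      exact mfderiv_comp (c x) hdf (hm.mdifferentiableAt_symm hct)
    rw [h1, ContinuousLinearMap.comp_assoc, hid, hsx, ContinuousLinearMap.comp_id]
  have hd : extDeriv (pullback c.symm (fun x => f x • α x)) (c x) =
      wedge (fderiv ℝ (f ∘ c.symm) (c x)) (pullback c.symm α (c x)) +
        f x • extDeriv (pullback c.symm α) (c x) := by
    rw [hp, extDeriv, fderiv_fun_smul hfd (differentiableAt_chart hW hα hx),
      ContinuousAlternatingMap.alternatizeUncurryFin_add,
      ContinuousAlternatingMap.alternatizeUncurryFin_smul]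
    refine (add_comm _ _).trans ?_
    simp [extDeriv, wedge, hc]
  have hpa : (pullback c.symm α (c x)).compContinuousLinearMap (dAt (E := E) (F := E) c x) =
      α x := by
    ext v
    have := fun i => congrArg (fun L : E →L[ℝ] E => L (v i)) hid
    simp only [ContinuousLinearMap.comp_apply, ContinuousLinearMap.id_apply] at this
    simp only [pullback, ContinuousAlternatingMap.compContinuousLinearMap_apply,
      Function.comp_def, this, hsx]
  have h2 : extD (fun x => f x • α x) x =
      (wedge (fderiv ℝ (f ∘ c.symm) (c x)) (pullback c.symm α (c x))).compContinuousLinearMap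
        (dAt (E := E) (F := E) c x) + f x • extD α x := by
    simp only [extD, ← hc, hd]
    ext v; simp
  rw [h2, wedge_comp, hfc, hpa]
  rfl

theorem isSmoothOn_dWedge {k : ℕ} {α : M → E [⋀^Fin k]→L[ℝ] ℝ} {W : Set M} {f : M → ℝ}
    (hf : ContMDiff 𝓘(ℝ, E) 𝓘(ℝ, ℝ) ∞ f) (hW : IsOpen W) (hα : IsSmoothOn α W) :
    IsSmoothOn (dWedge f α) W := by
  refine ((isSmoothOn_extD hW (hα.fun_smul hf)).add
    (((isSmoothOn_extD hW hα).fun_smul hf).smul (-1))).congr fun x hx => ?_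
  ext v
  simp [extD_fun_smul hf hW hα hx]

theorem extD_dWedge {k : ℕ} {α : M → E [⋀^Fin k]→L[ℝ] ℝ} {W : Set M} {f : M → ℝ}
    (hf : ContMDiff 𝓘(ℝ, E) 𝓘(ℝ, ℝ) ∞ f) (hW : IsOpen W) (hα : IsSmoothOn α W)
    {x : M} (hx : x ∈ W) : extD (dWedge f α) x = -dWedge f (extD α) x := by
  have h1 : EqOn (dWedge f α)
      (extD (fun x => f x • α x) + (-1 : ℝ) • fun x => f x • extD α x) W := fun x hx => by
    ext v
    simp [extD_fun_smul hf hW hα hx]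
  have hs := isSmoothOn_extD hW hα
  rw [extD_congr hW h1 hx, extD_add hW (isSmoothOn_extD hW (hα.fun_smul hf))
    ((hs.fun_smul hf).smul (-1)) hx, extD_smul, extD_extD hW (hα.fun_smul hf) hx,
    extD_fun_smul hf hW hs hx, extD_extD hW hα hx]
  ext v
  simp

theorem rawD_eq {k : ℕ} (f : M → ℝ) (α : M → E [⋀^Fin k]→L[ℝ] ℝ) :
    rawD f α = (fun x => f x • extD α x) + (-(k : ℝ)) • dWedge f α := by
  funext x; ext v; simp [rawD, sub_eq_add_neg]

theorem isSmoothOn_rawD {k : ℕ} {α : M → E [⋀^Fin k]→L[ℝ] ℝ} {W : Set M} {f : M → ℝ}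
    (hf : ContMDiff 𝓘(ℝ, E) 𝓘(ℝ, ℝ) ∞ f) (hW : IsOpen W) (hα : IsSmoothOn α W) :
    IsSmoothOn (rawD f α) W := by
  rw [rawD_eq]
  exact ((isSmoothOn_extD hW hα).fun_smul hf).add ((isSmoothOn_dWedge hf hW hα).smul _)

theorem rawD_rawD {k : ℕ} {α : M → E [⋀^Fin k]→L[ℝ] ℝ} {W : Set M} {f : M → ℝ}
    (hf : ContMDiff 𝓘(ℝ, E) 𝓘(ℝ, ℝ) ∞ f) (hW : IsOpen W) (hα : IsSmoothOn α W)
    {x : M} (hx : x ∈ W) : rawD f (rawD f α) x = 0 := by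
  have hs := isSmoothOn_extD hW hα
  have h1 : extD (rawD f α) x = (1 + (k : ℝ)) • dWedge f (extD α) x := by
    rw [rawD_eq, extD_add hW (hs.fun_smul hf) ((isSmoothOn_dWedge hf hW hα).smul _) hx,
      extD_smul, extD_dWedge hf hW hα hx, extD_fun_smul hf hW hs hx, extD_extD hW hα hx]
    simp [add_smul]
  have h2 : dWedge f (rawD f α) x = f x • dWedge f (extD α) x := by
    rw [rawD_eq]
    simp only [dWedge, Pi.add_apply, Pi.smul_apply, wedge_add, wedge_smul, wedge_wedge]
    simp
  rw [rawD, h1, h2]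
  ext v
  simp
  ring

theorem rawD_add {k : ℕ} {α η : M → E [⋀^Fin k]→L[ℝ] ℝ} {W : Set M} (f : M → ℝ) (hW : IsOpen W)
    (hα : IsSmoothOn α W) (hη : IsSmoothOn η W) {x : M} (hx : x ∈ W) :
    rawD f (α + η) x = rawD f α x + rawD f η x := by
  simp only [rawD, extD_add hW hα hη hx, dWedge, Pi.add_apply, wedge_add, smul_add]
  abel

theorem rawD_smul {k : ℕ} (f : M → ℝ) (c : ℝ) (α : M → E [⋀^Fin k]→L[ℝ] ℝ) (x : M) :
    rawD f (c • α) x = c • rawD f α x := by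
  simp only [rawD, extD_smul, dWedge, Pi.smul_apply, wedge_smul, smul_sub, smul_comm c]

/-- `d_f` commutes with pullbacks. -/
theorem pullback_rawD {k : ℕ} {α : M → E [⋀^Fin k]→L[ℝ] ℝ} {W : Set M} (f : M → ℝ)
    (hW : IsOpen W) (hα : IsSmoothOn α W) {γ : F → M} {O : Set F} (hO : IsOpen O)
    (hγ : ContMDiffOn 𝓘(ℝ, F) 𝓘(ℝ, E) ∞ γ O) {y : F} (hy : y ∈ O) (hyW : γ y ∈ W) :
    pullback γ (rawD f α) y = f (γ y) • extDeriv (pullback γ α) y -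
      (k : ℝ) • wedge ((dAt (E := ℝ) (F := E) f (γ y)).comp (dAt (E := E) (F := F) γ y))
        (pullback γ α y) := by
  have h : pullback γ (dWedge f α) y =
      wedge ((dAt (E := ℝ) (F := E) f (γ y)).comp (dAt (E := E) (F := F) γ y))
        (pullback γ α y) := wedge_comp _ _ _
  rw [extDeriv_pullback_eq hW hα hO hγ hy hyW, ← h]
  ext v
  simp [pullback, rawD]

end Raw

/-! ### Differential forms on a subset of a manifold -/

section Forms

variable {E : Type} [NormedAddCommGroup E] [NormedSpace ℝ E]
  {M : Type*} [TopologicalSpace M] [ChartedSpace E M]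

/-- The real vector space of all (not necessarily smooth) `k`-forms on `M`. -/
def RawForm (E : Type) [NormedAddCommGroup E] [NormedSpace ℝ E] (M : Type*) (k : ℕ) :=
  M → E [⋀^Fin k]→L[ℝ] ℝ

instance (k : ℕ) : AddCommGroup (RawForm E M k) :=
  inferInstanceAs (AddCommGroup (M → E [⋀^Fin k]→L[ℝ] ℝ))

instance (k : ℕ) : Module ℝ (RawForm E M k) :=
  inferInstanceAs (Module ℝ (M → E [⋀^Fin k]→L[ℝ] ℝ))

/-- The `k`-forms on `M` that are smooth on a neighbourhood of `A`. -/
def smoothNear (A : Set M) (k : ℕ) : Submodule ℝ (RawForm E M k) where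
  carrier := {α | ∃ W : Set M, IsOpen W ∧ A ⊆ W ∧ IsSmoothOn α W}
  add_mem' := by
    rintro α η ⟨W, hW, hA, h⟩ ⟨W', hW', hA', h'⟩
    exact ⟨W ∩ W', hW.inter hW', subset_inter hA hA',
      (h.mono inter_subset_left).add (h'.mono inter_subset_right)⟩
  zero_mem' := ⟨univ, isOpen_univ, subset_univ _, fun e _ => by
    exact (contDiffOn_const (c := 0)).congr fun y _ => rfl⟩
  smul_mem' := by
    rintro c α ⟨W, hW, hA, h⟩
    exact ⟨W, hW, hA, h.smul c⟩

/-- The `k`-forms on `M` that restrict to zero on `A`: the pullback by every smooth map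
`γ : O → M`, `O` open in some `ℝᵐ`, with values in `A` vanishes.

If `A` is an embedded submanifold, possibly with boundary, with inclusion `ι`, this
says `ι^* α = 0`; if `A` is open or the closure of an open set it says `α x = 0` for all `x ∈ A`
(for `α` smooth near `A`). -/
def nullOn (A : Set M) (k : ℕ) : Submodule ℝ (RawForm E M k) where
  carrier := {α | ∀ (m : ℕ) (O : Set (EuclideanSpace ℝ (Fin m)))
    (γ : EuclideanSpace ℝ (Fin m) → M), IsOpen O →
    ContMDiffOn 𝓘(ℝ, EuclideanSpace ℝ (Fin m)) 𝓘(ℝ, E) ∞ γ O → MapsTo γ O A →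
    ∀ y ∈ O, pullback γ α y = 0}
  add_mem' := by
    intro α η h h' m O γ hO hγ hA y hy
    refine (congrFun (pullback_add γ α η) y).trans ?_
    rw [Pi.add_apply, h m O γ hO hγ hA y hy, h' m O γ hO hγ hA y hy, add_zero]
  zero_mem' := by
    intro m O γ _ _ _ y _
    rfl
  smul_mem' := by
    intro c α h m O γ hO hγ hA y hy
    refine (congrFun (pullback_smul γ c α) y).trans ?_
    rw [Pi.smul_apply, h m O γ hO hγ hA y hy, smul_zero]

/-- The space `Ω^k(A)` of differential `k`-forms on a subset `A` of `M`: forms that are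
smooth on a neighbourhood of `A`, modulo those that restrict to zero on `A`.

For `A = M` this is the space of smooth `k`-forms on `M`, for an embedded submanifold `A`
(possibly with boundary) it is the usual space of smooth `k`-forms on `A`, and for the closure `A`
of an open set it is the quotient of `Ω^k(M)` by the forms that vanish at all points of `A`. -/
abbrev Form (E : Type) [NormedAddCommGroup E] [NormedSpace ℝ E]
    {M : Type*} [TopologicalSpace M] [ChartedSpace E M] (A : Set M) (k : ℕ) :=
  smoothNear (E := E) A k ⧸ (nullOn (E := E) A k).submoduleOf (smoothNear A k)

theorem mem_nullOn_of_eqOn {A : Set M} {k : ℕ} {α : RawForm E M k}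
    (h : ∀ x ∈ A, α x = (0 : E [⋀^Fin k]→L[ℝ] ℝ)) : α ∈ nullOn A k := by
  intro m O γ _ _ hA y hy
  simp only [pullback, h _ (hA hy)]
  rfl

theorem smoothNear_anti {A B : Set M} (h : A ⊆ B) (k : ℕ) :
    smoothNear (E := E) B k ≤ smoothNear A k := by
  rintro α ⟨W, hW, hB, hα⟩
  exact ⟨W, hW, h.trans hB, hα⟩

theorem nullOn_anti {A B : Set M} (h : A ⊆ B) (k : ℕ) :
    nullOn (E := E) B k ≤ nullOn A k :=
  fun _ hα m O γ hO hγ hA y hy => hα m O γ hO hγ (fun _ hz => h (hA hz)) y hy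

/-- The restriction map `Ω^k(B) → Ω^k(A)` for `A ⊆ B`. -/
def res {A B : Set M} (h : A ⊆ B) (k : ℕ) : Form E B k →ₗ[ℝ] Form E A k :=
  Submodule.mapQ _ _ (Submodule.inclusion (smoothNear_anti h k)) fun _ hα =>
    nullOn_anti h k hα

variable [IsManifold 𝓘(ℝ, E) ∞ M]

theorem rawD_mem_smoothNear (f : C^∞⟮𝓘(ℝ, E), M; ℝ⟯) {A : Set M} {k : ℕ}
    {α : RawForm E M k} (h : α ∈ smoothNear A k) :
    (rawD f α : RawForm E M (k + 1)) ∈ smoothNear A (k + 1) := by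
  obtain ⟨W, hW, hA, hα⟩ := h
  exact ⟨W, hW, hA, isSmoothOn_rawD f.contMDiff hW hα⟩

theorem rawD_mem_nullOn (f : C^∞⟮𝓘(ℝ, E), M; ℝ⟯) {A : Set M} {k : ℕ}
    {α : RawForm E M k} (h : α ∈ smoothNear A k) (h0 : α ∈ nullOn A k) :
    (rawD f α : RawForm E M (k + 1)) ∈ nullOn A (k + 1) := by
  obtain ⟨W, hW, hA, hα⟩ := h
  intro m O γ hO hγ hγA y hy
  have h1 : pullback γ α =ᶠ[𝓝 y] fun _ => 0 := by
    filter_upwards [hO.mem_nhds hy] with z hz using h0 m O γ hO hγ hγA z hz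
  have h2 : extDeriv (fun _ : EuclideanSpace ℝ (Fin m) =>
      (0 : EuclideanSpace ℝ (Fin m) [⋀^Fin k]→L[ℝ] ℝ)) y = 0 := by
    simp [extDeriv, ← ContinuousAlternatingMap.alternatizeUncurryFinCLM_apply]
  rw [pullback_rawD f hW hα hO hγ hy (hA (hγA hy)), h1.extDeriv_eq, h2, h1.self_of_nhds,
    wedge_zero, smul_zero, smul_zero, sub_zero]

/-- The differential `d_f : Ω^k(A) → Ω^{k+1}(A)`, `d_f α = f dα - k df ∧ α`. -/
def dForm (f : C^∞⟮𝓘(ℝ, E), M; ℝ⟯) (A : Set M) (k : ℕ) : Form E A k →ₗ[ℝ] Form E A (k + 1) :=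
  Submodule.liftQ _
    { toFun := fun α => Submodule.Quotient.mk ⟨rawD f α.1, rawD_mem_smoothNear f α.2⟩
      map_add' := by
        rintro ⟨α, W, hW, hA, hα⟩ ⟨η, W', hW', hA', hη⟩
        rw [← Submodule.Quotient.mk_add]
        refine (Submodule.Quotient.eq _).2 (mem_nullOn_of_eqOn fun x hx => ?_)
        have h := rawD_add f (hW.inter hW') (hα.mono inter_subset_left)
          (hη.mono inter_subset_right) ⟨hA hx, hA' hx⟩
        exact sub_eq_zero.2 h
      map_smul' := by
        rintro c ⟨α, hα⟩
        rw [RingHom.id_apply, ← Submodule.Quotient.mk_smul]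
        congr 1
        exact Subtype.ext (funext fun x => rawD_smul f c α x) }
    fun α hα => (Submodule.Quotient.mk_eq_zero _).2 (rawD_mem_nullOn f α.2 hα)

theorem dForm_dForm (f : C^∞⟮𝓘(ℝ, E), M; ℝ⟯) (A : Set M) (k : ℕ) (a : Form E A k) :
    dForm f A (k + 1) (dForm f A k a) = 0 := by
  induction a using Submodule.Quotient.induction_on with | _ α
  obtain ⟨α, W, hW, hA, hα⟩ := α
  exact (Submodule.Quotient.mk_eq_zero _).2
    (mem_nullOn_of_eqOn fun x hx => rawD_rawD f.contMDiff hW hα (hA hx))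

theorem res_dForm (f : C^∞⟮𝓘(ℝ, E), M; ℝ⟯) {A B : Set M} (h : A ⊆ B) (k : ℕ) (a : Form E B k) :
    res h (k + 1) (dForm f B k a) = dForm f A k (res h k a) := by
  induction a using Submodule.Quotient.induction_on with | _ α
  rfl

theorem res_res {A B A' B' : Set M} (h : A ⊆ B) (h' : A' ⊆ B') (hA : A' ⊆ A) (hB : B' ⊆ B) (k : ℕ)
    (a : Form E B k) : res hA k (res h k a) = res h' k (res hB k a) := by
  induction a using Submodule.Quotient.induction_on with | _ α
  rfl

end Forms

/-! ### The relative complex -/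

section Relative

universe u

variable {E : Type} [NormedAddCommGroup E] [NormedSpace ℝ E]
  {M : Type u} [TopologicalSpace M] [ChartedSpace E M]

/-- `Ω^k(B, A) = Ω^k(B) ⊕ Ω^{k-1}(A)`, with `Ω^{-1}(A) = 0`. -/
def relX (E : Type) [NormedAddCommGroup E] [NormedSpace ℝ E]
    {M : Type u} [TopologicalSpace M] [ChartedSpace E M] (B A : Set M) : ℕ → ModuleCat.{u} ℝ
  | 0 => ModuleCat.of ℝ (Form E B 0)
  | k + 1 => ModuleCat.of ℝ (Form E B (k + 1) × Form E A k)

variable [IsManifold 𝓘(ℝ, E) ∞ M]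

/-- `d(α, θ) = (d_f α, α|_A - d_f θ)`. -/
def relD (f : C^∞⟮𝓘(ℝ, E), M; ℝ⟯) {B A : Set M} (h : A ⊆ B) :
    ∀ k : ℕ, relX E B A k ⟶ relX E B A (k + 1)
  | 0 => ModuleCat.ofHom ((dForm f B 0).prod (res h 0))
  | k + 1 => ModuleCat.ofHom
      (((dForm f B (k + 1)).comp (LinearMap.fst ℝ _ _)).prod
        ((res h (k + 1)).comp (LinearMap.fst ℝ _ _) - (dForm f A k).comp (LinearMap.snd ℝ _ _)))

theorem relD_relD (f : C^∞⟮𝓘(ℝ, E), M; ℝ⟯) {B A : Set M} (h : A ⊆ B) (k : ℕ) :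
    relD f h k ≫ relD f h (k + 1) = 0 := by
  cases k with
  | zero =>
    refine ModuleCat.hom_ext (LinearMap.ext fun (a : Form E B 0) => ?_)
    exact Prod.ext (dForm_dForm f B 0 a) (sub_eq_zero.2 (res_dForm f h 0 a))
  | succ k =>
    refine ModuleCat.hom_ext (LinearMap.ext fun (a : Form E B (k + 1) × Form E A k) => ?_)
    refine Prod.ext (dForm_dForm f B (k + 1) a.1) (sub_eq_zero.2 ?_)
    change res h (k + 2) (dForm f B (k + 1) a.1) =
      dForm f A (k + 1) (res h (k + 1) a.1 - dForm f A k a.2)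
    rw [map_sub, dForm_dForm, sub_zero, res_dForm]

/-- The relative complex `Ω^•(B, A)` of a pair of subsets `A ⊆ B` of `M`. -/
def relComplex (f : C^∞⟮𝓘(ℝ, E), M; ℝ⟯) {B A : Set M} (h : A ⊆ B) :
    CochainComplex (ModuleCat.{u} ℝ) ℕ :=
  CochainComplex.of (relX E B A) (relD f h) (relD_relD f h)

theorem relComplex_d (f : C^∞⟮𝓘(ℝ, E), M; ℝ⟯) {B A : Set M} (h : A ⊆ B) (k : ℕ) :
    (relComplex f h).d k (k + 1) = relD f h k :=
  CochainComplex.of_d ..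

/-- The relative cohomology `H^k_f(B, A)`. -/
abbrev relCohomology (f : C^∞⟮𝓘(ℝ, E), M; ℝ⟯) {B A : Set M} (h : A ⊆ B) (k : ℕ) : ModuleCat.{u} ℝ :=
  (relComplex f h).homology k

/-- The components `(α, θ) ↦ (α|_{B'}, θ|_{A'})` of the map induced by `(B', A') ⊆ (B, A)`. -/
def relRes {B A B' A' : Set M} (hB : B' ⊆ B) (hA : A' ⊆ A) :
    ∀ k : ℕ, relX E B A k ⟶ relX E B' A' k
  | 0 => ModuleCat.ofHom (res hB 0)
  | k + 1 => ModuleCat.ofHom ((res hB (k + 1)).prodMap (res hA k))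

theorem relRes_comm (f : C^∞⟮𝓘(ℝ, E), M; ℝ⟯) {B A B' A' : Set M} (h : A ⊆ B) (h' : A' ⊆ B')
    (hB : B' ⊆ B) (hA : A' ⊆ A) (k : ℕ) :
    relRes hB hA k ≫ relD f h' k = relD f h k ≫ relRes hB hA (k + 1) := by
  cases k with
  | zero =>
    refine ModuleCat.hom_ext (LinearMap.ext fun (a : Form E B 0) => ?_)
    exact Prod.ext (res_dForm f hB 0 a).symm (res_res h h' hA hB 0 a).symm
  | succ k =>
    refine ModuleCat.hom_ext (LinearMap.ext fun (a : Form E B (k + 1) × Form E A k) => ?_)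
    refine Prod.ext (res_dForm f hB (k + 1) a.1).symm ?_
    change res h' (k + 1) (res hB (k + 1) a.1) - dForm f A' k (res hA k a.2) =
      res hA (k + 1) (res h (k + 1) a.1 - dForm f A k a.2)
    rw [map_sub, res_dForm, res_res h h' hA hB]

/-- The cochain map `Ω^•(B, A) → Ω^•(B', A')` induced by the inclusion `(B', A') ⊆ (B, A)`. -/
def relMap (f : C^∞⟮𝓘(ℝ, E), M; ℝ⟯) {B A B' A' : Set M} (h : A ⊆ B) (h' : A' ⊆ B')
    (hB : B' ⊆ B) (hA : A' ⊆ A) : relComplex f h ⟶ relComplex f h' :=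
  CochainComplex.ofHom (relRes hB hA) fun k => by
    rw [relComplex_d, relComplex_d]
    exact relRes_comm f h h' hB hA k

/-- The map `H^k_f(B, A) → H^k_f(B', A')` induced by the inclusion `(B', A') ⊆ (B, A)`. -/
def relCohomologyMap (f : C^∞⟮𝓘(ℝ, E), M; ℝ⟯) {B A B' A' : Set M} (h : A ⊆ B) (h' : A' ⊆ B')
    (hB : B' ⊆ B) (hA : A' ⊆ A) (k : ℕ) : relCohomology f h k ⟶ relCohomology f h' k :=
  HomologicalComplex.homologyMap (relMap f h h' hB hA) k

end Relative

end FunctionCohomology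

end

namespace FunctionCohomology

/-! ### Gluing smooth forms, and locality of vanishing. -/

section RawGluing

variable {E : Type} [NormedAddCommGroup E] [NormedSpace ℝ E]
  {M : Type*} [TopologicalSpace M] [ChartedSpace E M]

/-! Since the closure of `U` lies in the interior of `N`, the open sets `interior N` and `(closure
U)ᶜ` cover `M`. A smooth cutoff `χ`, equal to `1` near the closure of `U` and to `0` near the
complement of `interior N`, then gives in each degree a Mayer–Vietoris sequence `0 → Ω(M) → Ω(M \ U)
⊕ Ω(N) → Ω(N \ U) → 0`. Its exactness is the content of `eq_zero_of_res`, `exists_glue` and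
`exists_res_add_res`.

Up to sign and shift, the relative complex of a pair is the mapping cone of the restriction `Ω(B) →
Ω(A)`. Exactness of the sequence says that the square of restrictions between `M`, `N`, `M \ U` and
`N \ U` is bicartesian, so the two cones are quasi-isomorphic. `isIso_relCohomologyMap_excision`
carries this out as an explicit chase on cocycles.

The operator `d_f` enters the chase only through `d_f ∘ d_f = 0` and its compatibility with
restrictions. It does not commute with multiplication by `χ`, but it need not: the cutoff is used
only to establish exactness degree by degree. -/

theorem IsSmoothOn.union {k : ℕ} {α : M → E [⋀^Fin k]→L[ℝ] ℝ} {W W' : Set M}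
    (hW : IsOpen W) (hW' : IsOpen W') (h : IsSmoothOn α W) (h' : IsSmoothOn α W') :
    IsSmoothOn α (W ∪ W') := fun e he => by
  rw [preimage_union, inter_union_distrib_left]
  exact (h e he).union_of_isOpen (h' e he) (isOpen_chart hW e) (isOpen_chart hW' e)

theorem isSmoothOn_of_eqOn_zero {k : ℕ} {α : M → E [⋀^Fin k]→L[ℝ] ℝ} {W : Set M}
    (h : ∀ x ∈ W, α x = 0) : IsSmoothOn α W := fun e _ =>
  (contDiffOn_const (c := 0)).congr fun y hy => by
    simp only [pullback, h _ hy.2]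
    rfl

/-- A form restricts to zero on `A` as soon as it does so locally on `A`. -/
theorem mem_nullOn_of_locally {A : Set M} {k : ℕ} {α : RawForm E M k}
    (h : ∀ x ∈ A, α x = (0 : E [⋀^Fin k]→L[ℝ] ℝ) ∨
      ∃ V : Set M, IsOpen V ∧ x ∈ V ∧ α ∈ nullOn (A ∩ V) k) : α ∈ nullOn A k := by
  intro m O γ hO hγ hA y hy
  obtain h0 | ⟨V, hV, hyV, h0⟩ := h (γ y) (hA hy)
  · simp only [pullback, h0]
    rfl
  -- The test map stays the same; only its domain shrinks, to the open set where it takes values in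
  -- `A ∩ V`.
  · exact h0 m (O ∩ γ ⁻¹' V) γ (hγ.continuousOn.isOpen_inter_preimage hO hV)
      (hγ.mono inter_subset_left) (fun z hz => ⟨hA hz.1, hz.2⟩) y ⟨hy, hyV⟩

/-- The product of a function and a form. -/
def fmul {k : ℕ} (g : M → ℝ) (α : RawForm E M k) : RawForm E M k :=
  fun x => g x • (α x : E [⋀^Fin k]→L[ℝ] ℝ)

/-- Pullback is pointwise linear: `γ^*(g α) = (g ∘ γ) γ^* α`. Hence no regularity of `g` is needed.
-/
theorem fmul_mem_nullOn {A : Set M} {k : ℕ} {α : RawForm E M k} (g : M → ℝ)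
    (h : α ∈ nullOn A k) : fmul g α ∈ nullOn A k := by
  intro m O γ hO hγ hA y hy
  have h0 := h m O γ hO hγ hA y hy
  change g (γ y) • pullback γ α y = 0
  rw [h0, smul_zero]

/-- Extension by zero. A raw form has arbitrary values outside `W`, but multiplication by `g` erases
them on `Z`, so the product is smooth on all of `W ∪ Z`. -/
theorem fmul_mem_smoothNear [IsManifold 𝓘(ℝ, E) ∞ M] {A W : Set M} {k : ℕ} {α : RawForm E M k}
    {g : M → ℝ} (hg : ContMDiff 𝓘(ℝ, E) 𝓘(ℝ, ℝ) ∞ g) (hW : IsOpen W) (hα : IsSmoothOn α W)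
    {Z : Set M} (hZ : IsOpen Z) (hgZ : ∀ x ∈ Z, g x = 0) (hA : A ⊆ W ∪ Z) :
    fmul g α ∈ smoothNear A k :=
  ⟨W ∪ Z, hW.union hZ, hA, (hα.fun_smul hg).union hW hZ <|
    isSmoothOn_of_eqOn_zero fun x hx => (congrArg (· • _) (hgZ x hx)).trans (zero_smul ℝ _)⟩

end RawGluing

/-! ### The Mayer–Vietoris property of a closed cover by `Uᶜ` and `N` -/

section MayerVietoris

variable {E : Type} [NormedAddCommGroup E] [NormedSpace ℝ E]
  {M : Type*} [TopologicalSpace M] [ChartedSpace E M]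

/-- A smooth cutoff function for `(N, U)`: equal to `1` near the closure of `U` and supported in the
interior of `N`. -/
structure Cutoff (E : Type) [NormedAddCommGroup E] [NormedSpace ℝ E]
    {M : Type*} [TopologicalSpace M] [ChartedSpace E M] (N U : Set M) where
  /-- the cutoff function -/
  χ : M → ℝ
  smooth : ContMDiff 𝓘(ℝ, E) 𝓘(ℝ, ℝ) ∞ χ
  /-- the set where it is required to be one -/
  V : Set M
  isOpen_V : IsOpen V
  closure_subset : closure U ⊆ V
  eq_one : ∀ x ∈ V, χ x = 1
  /-- the set where it is required to be zero -/
  Z : Set M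
  isOpen_Z : IsOpen Z
  compl_subset : (interior N)ᶜ ⊆ Z
  eq_zero : ∀ x ∈ Z, χ x = 0

theorem exists_cutoff [FiniteDimensional ℝ E] [IsManifold 𝓘(ℝ, E) ∞ M] [T2Space M]
    [SigmaCompactSpace M] {N U : Set M} (hUN : closure U ⊆ interior N) :
    Nonempty (Cutoff E N U) := by
  -- With σ-compactness and the Hausdorff property this yields paracompactness, hence normality and
  -- smooth bump functions.
  have : LocallyCompactSpace M := Manifold.locallyCompact_of_finiteDimensional 𝓘(ℝ, E)
  -- The intermediate `V` makes `χ` vanish on the open set `(closure V)ᶜ`, a neighbourhood of the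
  -- complement of `interior N`; vanishing on that complement alone would not allow extension by
  -- zero.
  obtain ⟨V, hV, hUV, hVN⟩ := normal_exists_closure_subset isClosed_closure isOpen_interior hUN
  obtain ⟨χ, h1, h0, -⟩ := exists_contMDiffMap_one_nhds_of_subset_interior (n := ⊤) 𝓘(ℝ, E)
    (s := closure U) (t := closure V) isClosed_closure
    (hUV.trans (interior_maximal subset_closure hV))
  obtain ⟨V', hV', hUV', hχ⟩ := eventually_nhdsSet_iff_exists.1 h1
  exact ⟨⟨χ, χ.contMDiff, V', hV', hUV', hχ, (closure V)ᶜ, isClosed_closure.isOpen_compl,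
    compl_subset_compl.2 hVN, h0⟩⟩

variable [IsManifold 𝓘(ℝ, E) ∞ M] {N U : Set M}

theorem Cutoff.one_sub_smooth (c : Cutoff E N U) :
    ContMDiff 𝓘(ℝ, E) 𝓘(ℝ, ℝ) ∞ (fun x => 1 - c.χ x) :=
  contMDiff_const.sub c.smooth

theorem Cutoff.one_sub_eq_zero (c : Cutoff E N U) : ∀ x ∈ c.V, 1 - c.χ x = 0 :=
  fun x hx => by rw [c.eq_one x hx, sub_self]

theorem Cutoff.subset_V (c : Cutoff E N U) : U ⊆ c.V := subset_closure.trans c.closure_subset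

theorem Cutoff.mem_Z (c : Cutoff E N U) {x : M} (hx : x ∉ N) : x ∈ c.Z :=
  c.compl_subset fun h => hx (interior_subset h)

/-- A form on `M` that vanishes on `N` and on `M \ U` vanishes. -/
theorem eq_zero_of_res (hUN : closure U ⊆ interior N) {k : ℕ} {a : Form E (univ : Set M) k}
    (hN : res (subset_univ N) k a = 0) (hU : res (sdiff_subset (s := univ) (t := U)) k a = 0) :
    a = 0 := by
  induction a using Submodule.Quotient.induction_on with | _ α
  have hN' : α.1 ∈ nullOn N k :=
    (Submodule.Quotient.mk_eq_zero ((nullOn N k).submoduleOf (smoothNear N k))).1 hN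
  have hU' : α.1 ∈ nullOn (univ \ U) k :=
    (Submodule.Quotient.mk_eq_zero ((nullOn (univ \ U) k).submoduleOf (smoothNear (univ \ U) k))).1 hU
  -- Vanishing is local, and `interior N` and `(closure U)ᶜ` are open and cover `M`.
  refine (Submodule.Quotient.mk_eq_zero _).2 (mem_nullOn_of_locally fun x _ => .inr ?_)
  by_cases hx : x ∈ interior N
  · exact ⟨_, isOpen_interior, hx,
      nullOn_anti (inter_subset_right.trans interior_subset) k hN'⟩
  · exact ⟨_, isClosed_closure.isOpen_compl, fun h => hx (hUN h),
      nullOn_anti (B := univ \ U) (fun y hy => ⟨trivial, fun h => hy.2 (subset_closure h)⟩) k hU'⟩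

theorem eq_of_res (hUN : closure U ⊆ interior N) {k : ℕ} {a b : Form E (univ : Set M) k}
    (hN : res (subset_univ N) k a = res (subset_univ N) k b)
    (hU : res (sdiff_subset (s := univ) (t := U)) k a = res sdiff_subset k b) : a = b :=
  sub_eq_zero.1 <| eq_zero_of_res hUN (by rw [map_sub, hN, sub_self]) (by rw [map_sub, hU, sub_self])

/-- Every form on `N \ U` is the sum of a form on `M \ U` and a form on `N`. -/
theorem exists_res_add_res (c : Cutoff E N U) {k : ℕ} (a : Form E (N \ U) k) :
    ∃ (b : Form E (univ \ U) k) (v : Form E N k),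
      a = res (sdiff_subset_sdiff_left (subset_univ N)) k b + res sdiff_subset k v := by
  induction a using Submodule.Quotient.induction_on with | _ α
  obtain ⟨α, W, hW, hA, hα⟩ := α
  -- Split `α = χ α + (1 - χ) α`. The first summand extends by zero across the complement of `N`,
  -- the second across `U`.
  refine ⟨Submodule.Quotient.mk ⟨fmul c.χ α,
      fmul_mem_smoothNear c.smooth hW hα c.isOpen_Z c.eq_zero fun x hx => ?_⟩,
    Submodule.Quotient.mk ⟨fmul (fun x => 1 - c.χ x) α,
      fmul_mem_smoothNear c.one_sub_smooth hW hα c.isOpen_V c.one_sub_eq_zero fun x hx => ?_⟩, ?_⟩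
  · by_cases h : x ∈ N
    · exact .inl (hA ⟨h, hx.2⟩)
    · exact .inr (c.mem_Z h)
  · by_cases h : x ∈ U
    · exact .inr (c.subset_V h)
    · exact .inl (hA ⟨hx, h⟩)
  · refine congrArg Submodule.Quotient.mk (Subtype.ext (funext fun x => ?_))
    change α x = c.χ x • α x + (1 - c.χ x) • α x
    rw [← add_smul, add_sub_cancel, one_smul]

/-- Forms on `M \ U` and `N` that agree on `N \ U` come from a form on `M`. -/
theorem exists_glue (c : Cutoff E N U) {k : ℕ} (b : Form E (univ \ U) k) (v : Form E N k)
    (h : res (sdiff_subset_sdiff_left (subset_univ N)) k b = res (sdiff_subset (t := U)) k v) :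
    ∃ a : Form E (univ : Set M) k, res sdiff_subset k a = b ∧ res (subset_univ N) k a = v := by
  induction b using Submodule.Quotient.induction_on with | _ β
  induction v using Submodule.Quotient.induction_on with | _ ν
  have h0 : β.1 - ν.1 ∈ nullOn (N \ U) k :=
    (Submodule.Quotient.eq ((nullOn _ k).submoduleOf (smoothNear _ k))).1 h
  obtain ⟨β, W, hW, hA, hβ⟩ := β
  obtain ⟨ν, W', hW', hA', hν⟩ := ν
  have h1 : fmul c.χ ν ∈ smoothNear univ k :=
    fmul_mem_smoothNear c.smooth hW' hν c.isOpen_Z c.eq_zero fun x _ => by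
      by_cases h : x ∈ N
      · exact .inl (hA' h)
      · exact .inr (c.mem_Z h)
  have h2 : fmul (fun x => 1 - c.χ x) β ∈ smoothNear univ k :=
    fmul_mem_smoothNear c.one_sub_smooth hW hβ c.isOpen_V c.one_sub_eq_zero fun x _ => by
      by_cases h : x ∈ U
      · exact .inr (c.subset_V h)
      · exact .inl (hA ⟨trivial, h⟩)
  -- The glued form is `χ ν + (1 - χ) β`. It differs from `β` by `-χ (β - ν)` and from `ν` by `(1 -
  -- χ) (β - ν)`. Both errors restrict to zero: locally either `β - ν` is already null on `N \ U`,
  -- or the scalar factor vanishes at the point.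
  refine ⟨Submodule.Quotient.mk (⟨fmul c.χ ν, h1⟩ + ⟨fmul (fun x => 1 - c.χ x) β, h2⟩),
    (Submodule.Quotient.eq _).2 ?_, (Submodule.Quotient.eq _).2 ?_⟩
  · have e : fmul c.χ ν + fmul (fun x => 1 - c.χ x) β - β = fmul (fun x => -c.χ x) (β - ν) := by
      funext x
      change c.χ x • ν x + (1 - c.χ x) • β x - β x = (-c.χ x) • (β x - ν x)
      module
    change fmul c.χ ν + fmul (fun x => 1 - c.χ x) β - β ∈ nullOn (univ \ U) k
    rw [e]
    refine mem_nullOn_of_locally fun x hx => ?_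
    by_cases hxN : x ∈ interior N
    · exact .inr ⟨_, isOpen_interior, hxN, nullOn_anti (B := N \ U)
        (fun y hy => ⟨interior_subset hy.2, hy.1.2⟩) k (fmul_mem_nullOn _ h0)⟩
    · refine .inl ?_
      simp only [fmul, c.eq_zero x (c.compl_subset hxN), neg_zero, zero_smul]
  · have e : fmul c.χ ν + fmul (fun x => 1 - c.χ x) β - ν =
        fmul (fun x => 1 - c.χ x) (β - ν) := by
      funext x
      change c.χ x • ν x + (1 - c.χ x) • β x - ν x = (1 - c.χ x) • (β x - ν x)
      module
    change fmul c.χ ν + fmul (fun x => 1 - c.χ x) β - ν ∈ nullOn N k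
    rw [e]
    refine mem_nullOn_of_locally fun x hx => ?_
    by_cases hxU : x ∈ closure U
    · refine .inl ?_
      simp only [fmul, c.one_sub_eq_zero x (c.closure_subset hxU), zero_smul]
    · exact .inr ⟨_, isClosed_closure.isOpen_compl, hxU, nullOn_anti (B := N \ U)
        (fun y hy => ⟨hy.1, fun h => hy.2 (subset_closure h)⟩) k (fmul_mem_nullOn _ h0)⟩

end MayerVietoris

/-! ### Excision -/

/-- A map of short complexes of modules induces an isomorphism in homology if it does so on the
level of elements. -/
theorem isIso_homologyMap_of_elements {R : Type*} [Ring R] {S T : ShortComplex (ModuleCat R)}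
    (φ : S ⟶ T)
    (inj : ∀ x : S.X₂, S.g x = 0 → ∀ y : T.X₁, φ.τ₂ x = T.f y → ∃ z, x = S.f z)
    (surj : ∀ x : T.X₂, T.g x = 0 → ∃ z : S.X₂, S.g z = 0 ∧ ∃ y : T.X₁, T.f y = x - φ.τ₂ z) :
    IsIso (ShortComplex.homologyMap φ) := by
  -- Computing homology as the concrete quotient of a kernel by a range lets classes be handled
  -- through representatives.
  let γ : ShortComplex.LeftHomologyMapData φ S.moduleCatLeftHomologyData
    T.moduleCatLeftHomologyData := default
  have hi (x) : (γ.φK x).1 = φ.τ₂ x.1 := ConcreteCategory.congr_hom γ.commi x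
  have hπ (x) : γ.φH (Submodule.Quotient.mk x) = Submodule.Quotient.mk (γ.φK x) :=
    ConcreteCategory.congr_hom γ.commπ x
  have : IsIso γ.φH := by
    refine (ConcreteCategory.isIso_iff_bijective _).2
      ⟨(injective_iff_map_eq_zero γ.φH.hom).2 fun a ha => ?_, fun b => ?_⟩
    · obtain ⟨x, rfl⟩ := Submodule.Quotient.mk_surjective _ a
      obtain ⟨y, hy⟩ := (Submodule.Quotient.mk_eq_zero _).1 ((hπ x).symm.trans ha)
      obtain ⟨z, hz⟩ := inj x.1 x.2 y ((hi x).symm.trans (congrArg Subtype.val hy).symm)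
      exact (Submodule.Quotient.mk_eq_zero _).2 ⟨z, Subtype.ext hz.symm⟩
    · obtain ⟨x, rfl⟩ := Submodule.Quotient.mk_surjective _ b
      obtain ⟨z, hz, y, hy⟩ := surj x.1 x.2
      refine ⟨Submodule.Quotient.mk (⟨z, hz⟩ : LinearMap.ker S.g.hom), (hπ _).trans ?_⟩
      refine ((Submodule.Quotient.eq (LinearMap.range T.moduleCatToCycles)).2
        ⟨y, Subtype.ext (hy.trans ?_)⟩).symm
      exact congrArg (x.1 - ·) (hi (⟨z, hz⟩ : LinearMap.ker S.g.hom)).symm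
  rw [γ.homologyMap_eq]
  infer_instance

theorem isIso_cochainHomologyMap_of_elements {R : Type*} [Ring R]
    {K L : CochainComplex (ModuleCat R) ℕ} (φ : K ⟶ L) {i j k : ℕ}
    (hi : (ComplexShape.up ℕ).prev j = i) (hk : (ComplexShape.up ℕ).next j = k)
    (inj : ∀ x : K.X j, K.d j k x = 0 → ∀ y : L.X i, φ.f j x = L.d i j y → ∃ z, x = K.d i j z)
    (surj : ∀ x : L.X j, L.d j k x = 0 →
      ∃ z : K.X j, K.d j k z = 0 ∧ ∃ y : L.X i, L.d i j y = x - φ.f j z) :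
    IsIso (HomologicalComplex.homologyMap φ j) := by
  subst hi hk
  exact isIso_homologyMap_of_elements
    ((HomologicalComplex.shortComplexFunctor _ (ComplexShape.up ℕ) j).map φ) inj surj

/-! ### Elementwise criteria for relative cohomology and the diagram chase. -/

section Excision

universe u

variable {E : Type} [NormedAddCommGroup E] [NormedSpace ℝ E]
  {M : Type u} [TopologicalSpace M] [ChartedSpace E M] [IsManifold 𝓘(ℝ, E) ∞ M]
  (f : C^∞⟮𝓘(ℝ, E), M; ℝ⟯)

theorem relComplex_d_apply {B A : Set M} (h : A ⊆ B) (k : ℕ) (x : relX E B A k) :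
    (relComplex f h).d k (k + 1) x = relD f h k x :=
  ConcreteCategory.congr_hom (relComplex_d f h k) x

/-- In degree `0` there are no nonzero coboundaries, so the map in cohomology is the restriction of
cocycles: closed functions on the larger set of the pair that vanish on the smaller one. -/
theorem isIso_relCohomologyMap_zero {B A B' A' : Set M} (h : A ⊆ B) (h' : A' ⊆ B') (hB : B' ⊆ B)
    (hA : A' ⊆ A)
    (inj : ∀ x : Form E B 0, dForm f B 0 x = 0 → res h 0 x = 0 → res hB 0 x = 0 → x = 0)
    (surj : ∀ x : Form E B' 0, dForm f B' 0 x = 0 → res h' 0 x = 0 →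
      ∃ z : Form E B 0, dForm f B 0 z = 0 ∧ res h 0 z = 0 ∧ res hB 0 z = x) :
    IsIso (relCohomologyMap f h h' hB hA 0) := by
  have hd {B A : Set M} (h : A ⊆ B) (x) : (relComplex f h).d 0 0 x = 0 :=
    ConcreteCategory.congr_hom (HomologicalComplex.shape _ _ _ (by simp)) x
  -- In `ComplexShape.up ℕ` the predecessor of `0` is `0` itself by convention; the differential `d
  -- 0 0` is zero.
  refine isIso_cochainHomologyMap_of_elements _ (i := 0) (k := 1)
    CochainComplex.prev_nat_zero (CochainComplex.next ℕ 0) (fun x hx y hy => ?_) fun x hx => ?_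
  · have hx' := (relComplex_d_apply f h 0 x).symm.trans hx
    exact ⟨0, (inj x (congrArg Prod.fst hx') (congrArg Prod.snd hx')
      (hy.trans (hd h' y))).trans (hd h 0).symm⟩
  · have hx' := (relComplex_d_apply f h' 0 x).symm.trans hx
    obtain ⟨z, h1, h2, h3⟩ := surj x (congrArg Prod.fst hx') (congrArg Prod.snd hx')
    exact ⟨z, (relComplex_d_apply f h 0 z).trans (Prod.ext h1 h2), 0,
      (hd h' 0).trans (sub_eq_zero.2 h3.symm).symm⟩

/-- Cocycles are unpacked into pairs, while the cochains one degree lower remain elements of `relX`: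
they are pairs only when `k` is positive. -/
theorem isIso_relCohomologyMap_succ {B A B' A' : Set M} (h : A ⊆ B) (h' : A' ⊆ B') (hB : B' ⊆ B)
    (hA : A' ⊆ A) (k : ℕ)
    (inj : ∀ (x : Form E B (k + 1)) (u : Form E A k), dForm f B (k + 1) x = 0 →
      res h (k + 1) x - dForm f A k u = 0 → ∀ y : relX E B' A' k,
      (res hB (k + 1) x, res hA k u) = relD f h' k y → ∃ z : relX E B A k, (x, u) = relD f h k z)
    (surj : ∀ (x : Form E B' (k + 1)) (u : Form E A' k), dForm f B' (k + 1) x = 0 →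
      res h' (k + 1) x - dForm f A' k u = 0 →
      ∃ (z : Form E B (k + 1)) (w : Form E A k), dForm f B (k + 1) z = 0 ∧
        res h (k + 1) z - dForm f A k w = 0 ∧
        ∃ y : relX E B' A' k, relD f h' k y = (x - res hB (k + 1) z, u - res hA k w)) :
    IsIso (relCohomologyMap f h h' hB hA (k + 1)) := by
  refine isIso_cochainHomologyMap_of_elements _ (i := k) (k := k + 2)
    (CochainComplex.prev_nat_succ k) (CochainComplex.next ℕ (k + 1)) (fun x hx y hy => ?_)
    fun x hx => ?_
  · have hx' := (relComplex_d_apply f h (k + 1) x).symm.trans hx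
    obtain ⟨z, hz⟩ := inj x.1 x.2 (congrArg Prod.fst hx') (congrArg Prod.snd hx') y
      (hy.trans (relComplex_d_apply f h' k y))
    exact ⟨z, hz.trans (relComplex_d_apply f h k z).symm⟩
  · have hx' := (relComplex_d_apply f h' (k + 1) x).symm.trans hx
    obtain ⟨z, w, h1, h2, y, hy⟩ := surj x.1 x.2 (congrArg Prod.fst hx') (congrArg Prod.snd hx')
    exact ⟨(z, w), (relComplex_d_apply f h (k + 1) (z, w)).trans (Prod.ext h1 h2), y,
      (relComplex_d_apply f h' k y).trans hy⟩

theorem isIso_relCohomologyMap_excision {N U : Set M} (hUN : closure U ⊆ interior N)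
    (c : Cutoff E N U) (k : ℕ) :
    IsIso (relCohomologyMap f (B := univ) (A := N) (B' := univ \ U) (A' := N \ U)
      (subset_univ N) (sdiff_subset_sdiff_left (subset_univ N))
      sdiff_subset sdiff_subset k) := by
  cases k with
  | zero =>
    refine isIso_relCohomologyMap_zero f _ _ _ _ (fun x _ hN hU => eq_zero_of_res hUN hN hU)
      fun x hx hx' => ?_
    -- A cocycle on `M \ U` vanishes on `N \ U`, so it extends by zero over `N`.
    obtain ⟨a, ha, ha'⟩ := exists_glue c x 0 (by rw [hx', map_zero])
    refine ⟨a, eq_zero_of_res hUN ?_ ?_, ha', ha⟩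
    · rw [res_dForm, ha', map_zero]
    · rw [res_dForm, ha, hx]
  | succ k =>
    refine isIso_relCohomologyMap_succ f _ _ _ _ k (fun α θ hα hθ y hy => ?_)
      fun β θ hβ hθ => ?_
    · have hθ' := sub_eq_zero.1 hθ
      cases k with
      | zero =>
        change Form E (univ \ U) 0 at y
        have h1 : res sdiff_subset 1 α = dForm f (univ \ U) 0 y := congrArg Prod.fst hy
        have h2 : res sdiff_subset 0 θ = res _ 0 y := congrArg Prod.snd hy
        -- In degree one the primitive has no second component, so `y` and `θ` agree on `N \ U`
        -- without correction.
        obtain ⟨a, ha, ha'⟩ := exists_glue c y θ h2.symm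
        refine ⟨a, Prod.ext (eq_of_res hUN ?_ ?_) ha'.symm⟩
        · exact hθ'.trans (by rw [← ha']; exact (res_dForm f _ 0 a).symm)
        · exact h1.trans (by rw [← ha]; exact (res_dForm f _ 0 a).symm)
      | succ k =>
        obtain ⟨β, η⟩ : Form E (univ \ U) (k + 1) × Form E (N \ U) k := y
        have h1 : res sdiff_subset (k + 2) α = dForm f (univ \ U) (k + 1) β :=
          congrArg Prod.fst hy
        have h2 : res sdiff_subset (k + 1) θ =
            res (sdiff_subset_sdiff_left (subset_univ N)) (k + 1) β - dForm f (N \ U) k η :=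
          congrArg Prod.snd hy
        -- On `N \ U` one has `θ = β - d_f η`. Splitting `η = b + v` moves the two halves of the
        -- error to opposite sides: `β - d_f b` and `θ + d_f v` agree there and glue to `a`. Then
        -- `(a, v)` is a primitive of `(α, θ)`, the equality `d_f a = α` being checked on `N` and on
        -- `M \ U`.
        obtain ⟨b, v, rfl⟩ := exists_res_add_res c η
        obtain ⟨a, ha, ha'⟩ := exists_glue c (β - dForm f _ k b) (θ + dForm f N k v) (by
          rw [map_sub, map_add, h2, map_add, res_dForm, res_dForm]
          abel)
        refine ⟨(a, v), Prod.ext (eq_of_res hUN ?_ ?_) ?_⟩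
        · refine hθ'.trans (Eq.trans ?_ (res_dForm f _ (k + 1) a).symm)
          rw [ha', map_add, dForm_dForm, add_zero]
        · refine h1.trans (Eq.trans ?_ (res_dForm f _ (k + 1) a).symm)
          rw [ha, map_sub, dForm_dForm, sub_zero]
        · change θ = res (subset_univ N) (k + 1) a - dForm f N k v
          rw [ha', add_sub_cancel_right]
    -- Subtracting the coboundary of `b` (of `(b, 0)` in higher degrees) replaces `(β, θ)` by `(β -
    -- d_f b, v)` with `v` defined on all of `N`. The cocycle condition says that `β - d_f b` and
    -- `d_f v` agree on `N \ U`; gluing them gives `a`, and `(a, v)` is a cocycle on `(M, N)`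
    -- lifting the class.
    · obtain ⟨b, v, rfl⟩ := exists_res_add_res c θ
      have hθ' := sub_eq_zero.1 hθ
      obtain ⟨a, ha, ha'⟩ := exists_glue c (β - dForm f _ k b) (dForm f N k v) (by
        rw [map_sub, hθ', map_add, res_dForm, res_dForm, add_sub_cancel_left])
      refine ⟨a, v, eq_zero_of_res hUN ?_ ?_, by rw [ha', sub_self], ?_⟩
      · rw [res_dForm, ha', dForm_dForm]
      · rw [res_dForm, ha, map_sub, hβ, dForm_dForm, sub_zero]
      · cases k with
        | zero => exact ⟨b, Prod.ext (by rw [ha, sub_sub_cancel]; rfl) (add_sub_cancel_right _ _).symm⟩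
        | succ k =>
          refine ⟨(b, (0 : Form E (N \ U) k)), Prod.ext (by rw [ha, sub_sub_cancel]; rfl) ?_⟩
          change res (sdiff_subset_sdiff_left (subset_univ N)) (k + 1) b -
            dForm f (N \ U) k 0 = _
          rw [map_zero, sub_zero, add_sub_cancel_right]

end Excision

end FunctionCohomology

theorem mainTheorem7 {n : ℕ} {M : Type*} [TopologicalSpace M] [T2Space M]
    [SecondCountableTopology M] [ChartedSpace (EuclideanSpace ℝ (Fin n)) M]
    [IsManifold (𝓡 n) ∞ M] (f : C^∞⟮𝓡 n, M; ℝ⟯) (N U : Set M) (hU : IsOpen U)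
    (hUN : closure U ⊆ interior N) (k : ℕ) :
    IsIso (FunctionCohomology.relCohomologyMap f
      (B := univ) (A := N) (B' := univ \ U) (A' := N \ U)
      (subset_univ N) (sdiff_subset_sdiff_left (subset_univ N))
      sdiff_subset sdiff_subset k) := by
  -- Together with second countability this supplies the σ-compactness required by `exists_cutoff`.
  have : LocallyCompactSpace M := Manifold.locallyCompact_of_finiteDimensional (𝓡 n)
  obtain ⟨c⟩ := FunctionCohomology.exists_cutoff (E := EuclideanSpace ℝ (Fin n)) hUN
  exact FunctionCohomology.isIso_relCohomologyMap_excision f hUN c k
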